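/- Let $\mathcal H$ be a complex Hilbert space and let $G$ be a metric operator in $\mathcal H$, i.e. a (possibly unbounded) self-adjoint operator with $\langle G\xi,\xi\rangle\ge 0$ for all $\xi\in D(G)$, and $\langle G\xi,\xi\rangle=0$ only for $\xi=0$. Let $B$ be one of the following operators, each of which has a bounded inverse: $B=G^{-1/2}$ if $G$ is bounded; $B=G^{1/2}$ if $G^{-1}$ is bounded; $B=R_G^{1/2}$ with $R_G=I+G$, for any $G$. Let $V_{\mathcal G}=\{\mathcal H_n,\ n\in\mathbb Z\}$ be the Hilbert scale built on the powers of $B$: $\mathcal H_n=D(B^n)$ with norm $\|\xi\|_n=\|B^n\xi\|$ for $n\ge 0$, and $\mathcal H_{-n}=\mathcal H_n^\times$ (conjugate dual), so that $\mathcal H_0=\mathcal H$; the inner product of $\mathcal H$ extends to a pairing $\langle\cdot,\cdot\rangle$ of $\mathcal H_n$ with $\mathcal H_{-n}$. An operator in $V_{\mathcal G}$ is a linear map $A$ from a nonempty union $D(A)$ of spaces $\mathcal H_m$ into $\bigcup_n\mathcal H_n$ which maps every $\mathcal H_m\subset D(A)$ boundedly into some $\mathcal H_n$, and which has no proper extension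 of this kind. If $A$ maps $\mathcal H_m$ boundedly into $\mathcal H_n$, the restriction $A_{nm}:\mathcal H_m\to\mathcal H_n$ is called its $(m,n)$-representative. The operator is symmetric, $A=A^\times$, if for each representative $A_{nm}$ there is a representative $A_{-m,-n}:\mathcal H_{-n}\to\mathcal H_{-m}$ and $\langle A\eta,\xi\rangle=\langle\eta,A\xi\rangle$ for all $\xi\in\mathcal H_m$, $\eta\in\mathcal H_{-n}$. **Theorem.** Let $A=A^\times$ be a symmetric operator in $V_{\mathcal G}$, and let $m,n\in\mathbb Z$ be such that $\mathcal H_m\subset\mathcal H_n$ and $\mathcal H\subset\mathcal H_n$. (i) Assume that there is a $\lambda\in\mathbb R$ such that $A-\lambda I$ has a boundedly invertible representative $(A-\lambda I)_{nm}:\mathcal H_m\to\mathcal H_n$, i.e. $A_{nm}$ exists and $A_{nm}-\lambda E_{nm}$ is bijective with bounded inverse, where $E_{nm}:\mathcal H_m\to\mathcal H_n$ is the natural embedding. Then $A_{nm}$ has a unique restriction to a self-adjoint operator $\mathsf A$ in the Hilbert space $\mathcal H$; its domain is the dense subspace $D(\mathsf A)=\{\xi\in\mathcal H\cap\mathcal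 H_m:\ A_{nm}\xi\in\mathcal H\}$. In addition, $\lambda$ belongs to the resolvent set of $\mathsf A$. (ii) If, moreover, the natural embedding $\mathcal H_m\to\mathcal H_n$ is compact, then $\mathsf A$ has a purely point spectrum of finite multiplicity: the eigenvectors of $\mathsf A$ span a dense subspace of $\mathcal H$, $\sigma(\mathsf A)=\sigma_p(\mathsf A)$, every eigenvalue has a finite-dimensional eigenspace, and the continuous spectrum $\sigma_c(\mathsf A)$ is empty. -/

import Mathlib

noncomputable section

open scoped ComplexConjugate InnerProductSpace

/-! ### Metric operators -/

/-- A metric operator in a Hilbert space: a (possibly unbounded) self-adjoint operator `G` which is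
strictly positive, i.e. `⟪G ξ, ξ⟫ ≥ 0` with equality only for `ξ = 0`. Self-adjoint operators
(`LinearPMap`s equal to their adjoint) are densely defined. -/
def IsMetricOperator {H : Type*} [NormedAddCommGroup H] [InnerProductSpace ℂ H] [CompleteSpace H]
    (G : H →ₗ.[ℂ] H) : Prop :=
  IsSelfAdjoint G ∧ (∀ ξ : G.domain, 0 ≤ (⟪G ξ, (ξ : H)⟫_ℂ).re) ∧
    ∀ ξ : G.domain, ⟪G ξ, (ξ : H)⟫_ℂ = 0 ↔ ξ = 0

/-- The operator `R_G = I + G`, with the domain of `G`. -/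
def metricR {H : Type*} [NormedAddCommGroup H] [InnerProductSpace ℂ H]
    (G : H →ₗ.[ℂ] H) : H →ₗ.[ℂ] H :=
  (LinearMap.id : H →ₗ[ℂ] H) +ᵥ G

/-- A bounded metric operator: everywhere defined, bounded, positive and injective. -/
structure BoundedMetric (H : Type*) [NormedAddCommGroup H] [InnerProductSpace ℂ H]
    [CompleteSpace H] where
  /-- the underlying bounded operator -/
  op : H →L[ℂ] H
  isPositive : op.IsPositive
  injective : Function.Injective op

/-- `S` is the bounded operator from which the scale of the metric operator `G` is built:
* `S = G` if `G` is bounded (the scale is built on the powers of `S^{-1/2} = G^{-1/2}`);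
* `S = G⁻¹` if `G⁻¹` is bounded (the scale is built on the powers of `S^{-1/2} = G^{1/2}`);
* `S = R_G⁻¹`, for every `G` (the scale is built on the powers of `S^{-1/2} = R_G^{1/2}`). -/
def IsScaleBase {H : Type*} [NormedAddCommGroup H] [InnerProductSpace ℂ H] [CompleteSpace H]
    (G : H →ₗ.[ℂ] H) (S : BoundedMetric H) : Prop :=
  (S.op : H →ₗ[ℂ] H).toPMap ⊤ = G ∨ (S.op : H →ₗ[ℂ] H).toPMap ⊤ = G.inverse ∨
    (S.op : H →ₗ[ℂ] H).toPMap ⊤ = (metricR G).inverse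

/-- For every metric operator `G`, the operator `R_G⁻¹` is a bounded metric operator. -/
lemma exists_metricR_inverse {H : Type*} [NormedAddCommGroup H] [InnerProductSpace ℂ H]
    [CompleteSpace H] (G : H →ₗ.[ℂ] H) (hG : IsMetricOperator G) :
    ∃ S : BoundedMetric H, (S.op : H →ₗ[ℂ] H).toPMap ⊤ = (metricR G).inverse := by
  obtain ⟨hsa, hpos, -⟩ := hG
  have hdense := hsa.dense_domain
  have hbd : ∀ ξ : G.domain, ‖(ξ : H)‖ ≤ ‖(ξ : H) + G ξ‖ := fun ξ => by
    have h1 : ‖(ξ : H)‖ ^ 2 ≤ (⟪(ξ : H) + G ξ, (ξ : H)⟫_ℂ).re := by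
      rw [inner_add_left, Complex.add_re]
      have h2 := hpos ξ
      have h3 : ‖(ξ : H)‖ ^ 2 = (⟪(ξ : H), (ξ : H)⟫_ℂ).re := norm_sq_eq_re_inner (𝕜 := ℂ) (ξ : H)
      linarith
    have h2 : (⟪(ξ : H) + G ξ, (ξ : H)⟫_ℂ).re ≤ ‖(ξ : H) + G ξ‖ * ‖(ξ : H)‖ :=
      re_inner_le_norm (𝕜 := ℂ) _ _
    rcases (norm_nonneg (ξ : H)).eq_or_lt with h0 | h0
    · rw [← h0]; positivity
    · nlinarith
  have hclosed : IsClosed (LinearMap.range (metricR G).toFun : Set H) := by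
    rw [← isSeqClosed_iff_isClosed]
    intro u y hu hy
    choose x hx using hu
    have hx' : ∀ k, ((x k : H)) + G (x k) = u k := hx
    have hc : CauchySeq fun k => ((x k : H)) := by
      rw [Metric.cauchySeq_iff']
      intro ε hε
      obtain ⟨N, hN⟩ := Metric.cauchySeq_iff'.1 hy.cauchySeq ε hε
      refine ⟨N, fun k hk => lt_of_le_of_lt ?_ (hN k hk)⟩
      rw [dist_eq_norm, dist_eq_norm, ← hx', ← hx']
      have h4 := hbd (x k - x N)
      have h5 : G (x k - x N) = G (x k) - G (x N) := LinearMap.map_sub G.toFun _ _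
      rw [h5] at h4
      refine h4.trans (le_of_eq ?_)
      congr 1
      push_cast
      abel
    obtain ⟨x₀, hx₀⟩ := cauchySeq_tendsto_of_complete hc
    have hGx : Filter.Tendsto (fun k => G (x k)) Filter.atTop (nhds (y - x₀)) := by
      have h6 := hy.sub hx₀
      refine h6.congr fun k => ?_
      rw [← hx' k]; abel
    have hmem : (x₀, y - x₀) ∈ G.graph :=
      (hsa.isClosed : IsClosed (G.graph : Set (H × H))).mem_of_tendsto (hx₀.prodMk_nhds hGx)
        (Filter.Eventually.of_forall fun k => G.mem_graph (x k))
    rw [LinearPMap.mem_graph_iff] at hmem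
    obtain ⟨z, hz1, hz2⟩ := hmem
    refine ⟨z, ?_⟩
    change (z : H) + G z = y
    simp only at hz1 hz2
    rw [hz2, hz1]
    exact add_sub_cancel x₀ y
  have hrange : LinearMap.range (metricR G).toFun = ⊤ := by
    rw [← hclosed.submodule_topologicalClosure_eq, Submodule.topologicalClosure_eq_top_iff,
      Submodule.eq_bot_iff]
    intro η hη
    have h7 : ∀ ξ : G.domain, ⟪-η, (ξ : H)⟫_ℂ = ⟪η, G ξ⟫_ℂ := fun ξ => by
      have h8 : ⟪(ξ : H) + G ξ, η⟫_ℂ = 0 := (Submodule.mem_orthogonal _ _).1 hη _ ⟨ξ, rfl⟩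
      have h9 := inner_eq_zero_symm.1 h8
      rw [inner_add_right] at h9
      rw [inner_neg_left]
      linear_combination -h9
    have h10 : η ∈ G.adjoint.domain := LinearPMap.mem_adjoint_domain_of_exists η ⟨-η, h7⟩
    have h11 : G.adjoint ⟨η, h10⟩ = -η := LinearPMap.adjoint_apply_eq hdense ⟨η, h10⟩ h7
    have h12 : (η, -η) ∈ G.adjoint.graph := by
      rw [LinearPMap.mem_graph_iff]
      exact ⟨⟨η, h10⟩, rfl, h11⟩
    rw [LinearPMap.isSelfAdjoint_def.1 hsa, LinearPMap.mem_graph_iff] at h12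
    obtain ⟨z, hz1, hz2⟩ := h12
    simp only at hz1 hz2
    have h13 := hbd z
    rw [hz2, hz1] at h13
    simpa using h13
  have hinj : Function.Injective (metricR G).toFun := by
    rw [← LinearMap.ker_eq_bot, LinearMap.ker_eq_bot']
    intro ξ hξ
    have h14 := hbd ξ
    have h15 : (ξ : H) + G ξ = 0 := hξ
    rw [h15, norm_zero, norm_le_zero_iff] at h14
    exact Subtype.ext h14
  let e : G.domain ≃ₗ[ℂ] H :=
    LinearEquiv.ofBijective (metricR G).toFun ⟨hinj, LinearMap.range_eq_top.1 hrange⟩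
  have he : ∀ η : H, ((e.symm η : G.domain) : H) + G (e.symm η) = η := fun η =>
    e.apply_symm_apply η
  let R : H →L[ℂ] H := (G.domain.subtype ∘ₗ e.symm.toLinearMap).mkContinuous 1 fun η => by
    have h16 := hbd (e.symm η)
    rw [he] at h16
    simpa using h16
  have hR : ∀ η, R η = (e.symm η : H) := fun _ => rfl
  have hsymm : ∀ ξ ζ : G.domain, ⟪G ξ, (ζ : H)⟫_ℂ = ⟪(ξ : H), G ζ⟫_ℂ := by
    have := LinearPMap.adjoint_isFormalAdjoint hdense
    rw [LinearPMap.isSelfAdjoint_def.1 hsa] at this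
    exact this
  refine ⟨⟨R, ?_, ?_⟩, ?_⟩
  · rw [ContinuousLinearMap.isPositive_def']
    refine ⟨ContinuousLinearMap.isSelfAdjoint_iff_isSymmetric.2 fun x y => ?_, fun x => ?_⟩
    · change ⟪R x, y⟫_ℂ = ⟪x, R y⟫_ℂ
      rw [hR, hR]
      conv_lhs => rw [← he y]
      conv_rhs => rw [← he x]
      rw [inner_add_left, inner_add_right, hsymm]
    · rw [ContinuousLinearMap.reApplyInnerSelf_apply, hR]
      have h19 : ⟪((e.symm x : G.domain) : H), x⟫_ℂ =
          ⟪((e.symm x : G.domain) : H), ((e.symm x : G.domain) : H)⟫_ℂ +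
            ⟪((e.symm x : G.domain) : H), G (e.symm x)⟫_ℂ := by
        rw [← inner_add_right, he]
      rw [h19, map_add]
      have h17 := hpos (e.symm x)
      rw [hsymm] at h17
      have h18 := inner_self_nonneg (𝕜 := ℂ) (x := ((e.symm x : G.domain) : H))
      exact add_nonneg h18 h17
  · intro x y hxy
    exact e.symm.injective (Subtype.ext hxy)
  · have hker : LinearMap.ker (metricR G).toFun = ⊥ := LinearMap.ker_eq_bot.2 hinj
    refine LinearPMap.ext (by rw [LinearPMap.inverse_domain, hrange]; rfl) fun x hx hy => ?_
    exact (LinearPMap.inverse_apply_eq hker (y := ⟨x, hy⟩) (x := e.symm x) (he x)).symm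

/-! ### The Hilbert scale

Throughout, `S` is a bounded metric operator, `C = S^{1/2}` and `B = C⁻¹ = S^{-1/2}`. The scale
is `H_n = D(B^n)` for `n ≥ 0`, with the norm `‖ξ‖_n = ‖B^n ξ‖`, and `H_{-n} = H_n^×`. All the
spaces are realized inside the space of antilinear functionals on `V^# = ⋂ H_n`. -/

namespace BoundedMetric

variable {H : Type*} [NormedAddCommGroup H] [InnerProductSpace ℂ H] [CompleteSpace H]

/-- The positive square root `C = S^{1/2}`. -/
def root (S : BoundedMetric H) : H →L[ℂ] H := CFC.sqrt S.op

lemma root_nonneg (S : BoundedMetric H) : 0 ≤ S.root := CFC.sqrt_nonneg _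

lemma root_mul_root (S : BoundedMetric H) : S.root * S.root = S.op :=
  CFC.sqrt_mul_sqrt_self S.op (S.op.nonneg_iff_isPositive.2 S.isPositive)

lemma root_injective (S : BoundedMetric H) : Function.Injective S.root := by
  intro x y h
  apply S.injective
  rw [← S.root_mul_root]
  simp [h]

lemma root_selfAdjoint (S : BoundedMetric H) : IsSelfAdjoint S.root :=
  IsSelfAdjoint.of_nonneg S.root_nonneg

lemma inner_root (S : BoundedMetric H) (x y : H) : ⟪S.root x, y⟫_ℂ = ⟪x, S.root y⟫_ℂ :=
  (ContinuousLinearMap.isSelfAdjoint_iff_isSymmetric.1 S.root_selfAdjoint) x y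

/-- `V^# = ⋂ₙ D(B^n)`; here `D(B^n)` is the range of `C^n = B^{-n}`. -/
def core (S : BoundedMetric H) : Submodule ℂ H :=
  ⨅ n : ℕ, LinearMap.range ((S.root ^ n : H →L[ℂ] H) : H →ₗ[ℂ] H)

lemma mem_core (S : BoundedMetric H) {x : H} : x ∈ S.core ↔ ∀ n : ℕ, ∃ y, (S.root ^ n) y = x := by
  simp only [core, Submodule.mem_iInf, LinearMap.mem_range, ContinuousLinearMap.coe_coe]

/-- `V^#` is dense in `H`. -/
lemma dense_core (S : BoundedMetric H) : Dense (S.core : Set H) := by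
  have hsa := S.root_selfAdjoint
  have hspec : ∀ x ∈ spectrum ℝ S.root, 0 ≤ x := fun x hx =>
    spectrum_nonneg_of_nonneg S.root_nonneg hx
  -- the range of `C` is dense
  have h1 : Dense (Set.range S.root) := by
    have : (LinearMap.range (S.root : H →ₗ[ℂ] H)).topologicalClosure = ⊤ := by
      rw [Submodule.topologicalClosure_eq_top_iff, Submodule.eq_bot_iff]
      intro x hx
      rw [Submodule.mem_orthogonal] at hx
      apply S.root_injective
      rw [map_zero, ← inner_self_eq_zero (𝕜 := ℂ)]
      rw [← S.inner_root]
      exact hx _ ⟨S.root x, rfl⟩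
    have h2 := (Submodule.dense_iff_topologicalClosure_eq_top).2 this
    exact h2
  -- approximate `C` by the truncations `max (C - ε) 0`
  have h3 : Set.range S.root ⊆ closure (S.core : Set H) := by
    rintro _ ⟨h, rfl⟩
    rw [Metric.mem_closure_iff]
    intro δ hδ
    obtain ⟨ε, hε, hεδ⟩ : ∃ ε > 0, ε * ‖h‖ < δ := by
      refine ⟨δ / (‖h‖ + 1), by positivity, ?_⟩
      rw [div_mul_eq_mul_div, div_lt_iff₀ (by positivity)]
      nlinarith [norm_nonneg h]
    refine ⟨(cfc (fun x : ℝ => max (x - ε) 0) S.root) h, ?_, ?_⟩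
    · rw [SetLike.mem_coe, mem_core]
      intro n
      have hg : Continuous fun x : ℝ => max (x - ε) 0 / (max x ε) ^ n := by
        refine Continuous.div (by fun_prop) (by fun_prop) fun x => ?_
        have : 0 < max x ε := lt_max_of_lt_right hε
        positivity
      refine ⟨(cfc (fun x : ℝ => max (x - ε) 0 / (max x ε) ^ n) S.root) h, ?_⟩
      rw [← mul_apply_eq_comp]
      congr 1
      have hpow : S.root ^ n = cfc (fun x : ℝ => x ^ n) S.root := by
        rw [cfc_pow_id (R := ℝ) S.root n]
      conv_lhs => rw [hpow]
      rw [← cfc_mul (fun x : ℝ => x ^ n) _ S.root (by fun_prop) hg.continuousOn]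
      apply cfc_congr
      intro x hx
      have hx0 := hspec x hx
      show x ^ n * (max (x - ε) 0 / (max x ε) ^ n) = max (x - ε) 0
      rcases le_total x ε with hle | hle
      · rw [max_eq_right (by linarith)]; simp
      · rw [max_eq_left hle]
        have : 0 < x := lt_of_lt_of_le hε hle
        field_simp
    · have hC : S.root = cfc (fun x : ℝ => x) S.root := (cfc_id' ℝ S.root).symm
      rw [dist_eq_norm, ← sub_apply]
      refine lt_of_le_of_lt ((S.root - _).le_opNorm h) (lt_of_le_of_lt ?_ hεδ)
      gcongr
      conv_lhs => enter [1, 1]; rw [hC]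
      rw [← cfc_sub (fun x : ℝ => x) _ S.root (by fun_prop) (by fun_prop)]
      refine norm_cfc_le hε.le fun x hx => ?_
      have hx0 := hspec x hx
      rw [Real.norm_eq_abs, abs_le]
      constructor <;> rcases le_total x ε with hle | hle
      · rw [max_eq_right (by linarith)]; linarith
      · rw [max_eq_left (by linarith)]; linarith
      · rw [max_eq_right (by linarith)]; linarith
      · rw [max_eq_left (by linarith)]; linarith
  rw [dense_iff_closure_eq, ← Set.univ_subset_iff, ← h1.closure_eq]
  exact closure_minimal h3 isClosed_closure

lemma root_mem_core (S : BoundedMetric H) {x : H} (hx : x ∈ S.core) : S.root x ∈ S.core := by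
  rw [mem_core] at hx ⊢
  intro n
  obtain ⟨y, rfl⟩ := hx n
  refine ⟨S.root y, ?_⟩
  rw [← mul_apply_eq_comp, ← mul_apply_eq_comp, ← pow_succ, ← pow_succ']

/-- `C` restricts to a bijection of `V^#`; its inverse is the restriction of `B`. -/
def coreShift (S : BoundedMetric H) : S.core ≃ₗ[ℂ] S.core :=
  LinearEquiv.ofBijective
    ((S.root : H →ₗ[ℂ] H).restrict fun _ hx => S.root_mem_core hx) <| by
    constructor
    · intro x y h
      exact Subtype.ext (S.root_injective (congrArg Subtype.val h))
    · rintro ⟨x, hx⟩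
      rw [mem_core] at hx
      obtain ⟨y, hy⟩ := hx 1
      rw [pow_one] at hy
      refine ⟨⟨y, ?_⟩, Subtype.ext hy⟩
      rw [mem_core]
      intro n
      obtain ⟨z, hz⟩ := hx (n + 1)
      refine ⟨z, S.root_injective ?_⟩
      rw [hy, ← hz, pow_succ']
      rfl

/-- `C^n = B^{-n}` on `V^#`, for all integers `n`. -/
def corePow (S : BoundedMetric H) (n : ℤ) : S.core ≃ₗ[ℂ] S.core := S.coreShift ^ n

/-- The ambient space of the scale: the antilinear functionals on `V^#`. -/
def Total (S : BoundedMetric H) : Type _ := S.core →ₗ⋆[ℂ] ℂ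

instance (S : BoundedMetric H) : AddCommGroup S.Total :=
  inferInstanceAs (AddCommGroup (S.core →ₗ⋆[ℂ] ℂ))

instance (S : BoundedMetric H) : Module ℂ S.Total :=
  inferInstanceAs (Module ℂ (S.core →ₗ⋆[ℂ] ℂ))

/-- An element of the ambient space as an antilinear functional. -/
def Total.toFunctional {S : BoundedMetric H} (f : S.Total) : S.core →ₗ⋆[ℂ] ℂ := f

/-- The value `⟪φ, f⟫` of `f` at `φ ∈ V^#`. -/
def eval (S : BoundedMetric H) (φ : S.core) : S.Total →ₗ[ℂ] ℂ where
  toFun f := f.toFunctional φ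
  map_add' _ _ := rfl
  map_smul' _ _ := rfl

lemma eval_ext (S : BoundedMetric H) {f g : S.Total} (h : ∀ φ, S.eval φ f = S.eval φ g) : f = g :=
  LinearMap.ext (f := f.toFunctional) (g := g.toFunctional) h

/-- The element `C^n h = B^{-n} h` of the ambient space, for `h ∈ H` and any integer `n`:
the functional `φ ↦ ⟪C^n φ, h⟫` on `V^#`. -/
def negPow (S : BoundedMetric H) (n : ℤ) : H →ₗ[ℂ] S.Total where
  toFun h := (((innerₛₗ ℂ).flip h).comp (S.core.subtype.comp (S.corePow n).toLinearMap) :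
    S.core →ₗ⋆[ℂ] ℂ)
  map_add' x y := S.eval_ext fun φ =>
    inner_add_right (𝕜 := ℂ) ((S.corePow n φ : S.core) : H) x y
  map_smul' c x := S.eval_ext fun φ =>
    inner_smul_right (𝕜 := ℂ) ((S.corePow n φ : S.core) : H) x c

lemma eval_negPow (S : BoundedMetric H) (n : ℤ) (h : H) (φ : S.core) :
    S.eval φ (S.negPow n h) = ⟪((S.corePow n φ : S.core) : H), h⟫_ℂ := rfl

lemma negPow_injective (S : BoundedMetric H) (n : ℤ) : Function.Injective (S.negPow n) := by
  intro x y hxy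
  refine S.dense_core.eq_of_inner_right ℂ fun v hv => ?_
  have := congrArg (S.eval ((S.corePow n).symm ⟨v, hv⟩)) hxy
  simpa only [eval_negPow, LinearEquiv.apply_symm_apply] using this

/-- The embedding of `H` into the ambient space, `ξ ↦ ⟪·, ξ⟫`. -/
def embed (S : BoundedMetric H) : H →ₗ[ℂ] S.Total := S.negPow 0

/-- The space `H_n = B^{-n} H` of the Hilbert scale, `n ∈ ℤ`. For `n ≥ 0` it is `D(B^n)`, see
`mem_scale_natCast`; for `n = -k ≤ 0` it is the conjugate dual of `H_k`,
see `mem_scale_neg_natCast`. -/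
def scale (S : BoundedMetric H) (n : ℤ) : Submodule ℂ S.Total := LinearMap.range (S.negPow n)

/-- The bijection `B^n : H_n → H`. -/
def coord (S : BoundedMetric H) (n : ℤ) : S.scale n ≃ₗ[ℂ] H :=
  (LinearEquiv.ofInjective (S.negPow n) (S.negPow_injective n)).symm

lemma negPow_coord (S : BoundedMetric H) (n : ℤ) (f : S.scale n) :
    S.negPow n (S.coord n f) = f :=
  congrArg Subtype.val
    ((LinearEquiv.ofInjective (S.negPow n) (S.negPow_injective n)).apply_symm_apply f)

/-- The norm `‖f‖_n = ‖B^n f‖` of `H_n`. -/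
instance (S : BoundedMetric H) (n : ℤ) : NormedAddCommGroup (S.scale n) :=
  NormedAddCommGroup.induced (S.scale n) H (S.coord n) (S.coord n).injective

/-- The inner product `⟪f, g⟫_n = ⟪B^n f, B^n g⟫` of `H_n`. -/
instance (S : BoundedMetric H) (n : ℤ) : InnerProductSpace ℂ (S.scale n) where
  norm_smul_le a f := by
    change ‖S.coord n (a • f)‖ ≤ ‖a‖ * ‖S.coord n f‖
    rw [map_smul, norm_smul]
  inner f g := ⟪S.coord n f, S.coord n g⟫_ℂ
  norm_sq_eq_re_inner f := norm_sq_eq_re_inner (𝕜 := ℂ) (S.coord n f)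
  conj_inner_symm _ _ := inner_conj_symm _ _
  add_left _ _ _ := by simp only [map_add, inner_add_left]
  smul_left _ _ _ := by simp only [map_smul, inner_smul_left]

/-- `B^n : H_n → H` is unitary. -/
def coordIsometry (S : BoundedMetric H) (n : ℤ) : S.scale n ≃ₗᵢ[ℂ] H where
  toLinearEquiv := S.coord n
  norm_map' _ := rfl

/-- `H_n` is a Hilbert space. -/
instance (S : BoundedMetric H) (n : ℤ) : CompleteSpace (S.scale n) :=
  (S.coordIsometry n).toIsometryEquiv.completeSpace

lemma continuous_eval (S : BoundedMetric H) (n : ℤ) (φ : S.core) :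
    Continuous fun f : S.scale n => S.eval φ (f : S.Total) := by
  have h : (fun f : S.scale n => S.eval φ (f : S.Total)) =
      fun f => ⟪((S.corePow n φ : S.core) : H), S.coordIsometry n f⟫_ℂ := by
    funext f
    rw [← S.negPow_coord n f, eval_negPow]
    rfl
  rw [h]
  exact continuous_const.inner (S.coordIsometry n).continuous

/-- The natural embedding `H_m → H_n` (bounded), when `H_m ⊆ H_n`. -/
def inclusion (S : BoundedMetric H) {m n : ℤ} (h : S.scale m ≤ S.scale n) :
    S.scale m →L[ℂ] S.scale n where
  toLinearMap := Submodule.inclusion h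
  cont := by
    refine (Submodule.inclusion h).continuous_of_seq_closed_graph fun u x y hu hv => ?_
    refine Subtype.ext (S.eval_ext fun φ => ?_)
    have h1 := ((S.continuous_eval n φ).tendsto y).comp hv
    have h2 := ((S.continuous_eval m φ).tendsto x).comp hu
    exact tendsto_nhds_unique h1 h2

/-- The pairing `⟪f, g⟫ = ⟪B^j f, B^k g⟫` of `f ∈ H_j` and `g ∈ H_k`, where `k = -j`; it extends
the inner product of `H`. -/
def pairing (S : BoundedMetric H) {j k : ℤ} (_ : j + k = 0) (f : S.scale j) (g : S.scale k) : ℂ :=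
  ⟪S.coord j f, S.coord k g⟫_ℂ

lemma coe_corePow_natCast (S : BoundedMetric H) (n : ℕ) (φ : S.core) :
    ((S.corePow n φ : S.core) : H) = (S.root ^ n) φ := by
  induction n with
  | zero => simp [corePow]
  | succ n ih =>
    have : S.corePow ((n + 1 : ℕ) : ℤ) φ = S.coreShift (S.corePow n φ) := by
      simp only [corePow, zpow_natCast, pow_succ']
      rfl
    rw [this, pow_succ', mul_apply_eq_comp, ← ih]
    rfl

lemma inner_root_pow (S : BoundedMetric H) (n : ℕ) (x y : H) :
    ⟪(S.root ^ n) x, y⟫_ℂ = ⟪x, (S.root ^ n) y⟫_ℂ :=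
  (ContinuousLinearMap.isSelfAdjoint_iff_isSymmetric.1 (S.root_selfAdjoint.pow n)) x y

lemma negPow_natCast (S : BoundedMetric H) (n : ℕ) (h : H) :
    S.negPow n h = S.embed ((S.root ^ n) h) := by
  refine S.eval_ext fun φ => ?_
  rw [embed, eval_negPow, eval_negPow, coe_corePow_natCast, inner_root_pow]
  simp [corePow]

/-- For `n ≥ 0`, `H_n` is the range of `C^n`, i.e. the domain of `B^n`. -/
lemma mem_scale_natCast (S : BoundedMetric H) (n : ℕ) (f : S.Total) :
    f ∈ S.scale n ↔ ∃ ξ ∈ LinearMap.range ((S.root ^ n : H →L[ℂ] H) : H →ₗ[ℂ] H),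
      S.embed ξ = f := by
  simp only [scale, LinearMap.mem_range, negPow_natCast]
  constructor
  · rintro ⟨h, rfl⟩
    exact ⟨_, ⟨h, rfl⟩, rfl⟩
  · rintro ⟨_, ⟨h, rfl⟩, rfl⟩
    exact ⟨h, rfl⟩

/-- For `k ≥ 0`, `H_{-k}` is the conjugate dual of `H_k`: it consists of the antilinear functionals
on `V^#` which are bounded for the norm `‖φ‖_k = ‖B^k φ‖`. -/
lemma mem_scale_neg_natCast (S : BoundedMetric H) (k : ℕ) (f : S.Total) :
    f ∈ S.scale (-k) ↔
      ∃ c : ℝ, ∀ φ : S.core, ‖S.eval φ f‖ ≤ c * ‖((S.corePow (-k) φ : S.core) : H)‖ := by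
  constructor
  · rintro ⟨h, rfl⟩
    refine ⟨‖h‖, fun φ => ?_⟩
    rw [eval_negPow, mul_comm]
    exact norm_inner_le_norm _ _
  · rintro ⟨c, hc⟩
    let g : S.core →ₗ[ℂ] ℂ :=
      { toFun := fun φ => conj (S.eval ((S.corePow (-k)).symm φ) f)
        map_add' := fun x y => by
          rw [← map_add]
          exact congrArg conj ((congrArg f.toFunctional (map_add _ x y)).trans (map_add f.toFunctional _ _))
        map_smul' := fun a x => by
          rw [map_smul]
          have := LinearMap.map_smulₛₗ f.toFunctional a ((S.corePow (-k)).symm x)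
          refine (congrArg conj this).trans ?_
          simp only [smul_eq_mul, map_mul, Complex.conj_conj, RingHom.id_apply]
          rfl }
    let g' : S.core →L[ℂ] ℂ := g.mkContinuous c fun φ => by
      have := hc ((S.corePow (-k)).symm φ)
      rw [LinearEquiv.apply_symm_apply] at this
      simpa [g] using this
    let G := g'.extend S.core.subtypeL
    refine ⟨(InnerProductSpace.toDual ℂ H).symm G, S.eval_ext fun φ => ?_⟩
    rw [eval_negPow, ← inner_conj_symm, InnerProductSpace.toDual_symm_apply]
    have h1 : G ((S.corePow (-k) φ : S.core) : H) = g' (S.corePow (-k) φ) :=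
      ContinuousLinearMap.extend_eq _ S.dense_core.denseRange_val
        isUniformEmbedding_subtype_val.isUniformInducing _
    rw [h1]
    simp [g', g]

/-! ### Operators in the scale -/

/-- `T : H_m → H_n` (bounded) is the `(m, n)`-representative of `A`, i.e. the restriction of `A`
to `H_m`. Given `A`, the set `j(A)` consists of the pairs `(m, n)` for which there is one. -/
def IsRepresentative (S : BoundedMetric H) (A : S.Total →ₗ.[ℂ] S.Total) {m n : ℤ}
    (T : S.scale m →L[ℂ] S.scale n) : Prop :=
  ∀ f : S.scale m, ∃ hf : (f : S.Total) ∈ A.domain, A ⟨f, hf⟩ = T f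

/-- The domain of `A` is a nonempty union of spaces `H_m` of the scale, and `A` maps each `H_m`
contained in its domain boundedly into some `H_n`. -/
def IsPreOperator (S : BoundedMetric H) (A : S.Total →ₗ.[ℂ] S.Total) : Prop :=
  (∃ m, S.scale m ≤ A.domain) ∧
  (∀ f ∈ A.domain, ∃ m, f ∈ S.scale m ∧ S.scale m ≤ A.domain) ∧
  ∀ m, S.scale m ≤ A.domain →
    ∃ (n : ℤ) (T : S.scale m →L[ℂ] S.scale n), S.IsRepresentative A T

/-- `A ∈ Op(V)`: `A` is as in `IsPreOperator` and has no proper extension of this kind. -/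
def IsOperator (S : BoundedMetric H) (A : S.Total →ₗ.[ℂ] S.Total) : Prop :=
  S.IsPreOperator A ∧ ∀ A', S.IsPreOperator A' → A ≤ A' → A' = A

/-- `A' = A^×`, for operators `A, A'` in the scale: for every representative `H_m → H_n` of `A`,
the operator `A'` has a representative `H_{-n} → H_{-m}`, and `⟪A' g, f⟫ = ⟪g, A f⟫`
for all `f ∈ H_m` and `g ∈ H_{-n}`. -/
def IsAdjointOperator (S : BoundedMetric H) (A A' : S.Total →ₗ.[ℂ] S.Total) : Prop :=
  ∀ (m n : ℤ) (T : S.scale m →L[ℂ] S.scale n), S.IsRepresentative A T →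
    ∃ T' : S.scale (-n) →L[ℂ] S.scale (-m), S.IsRepresentative A' T' ∧
      ∀ (f : S.scale m) (g : S.scale (-n)),
        S.pairing (neg_add_cancel m) (T' g) f = S.pairing (neg_add_cancel n) g (T f)

/-- `A` is a symmetric operator in the scale: `A ∈ Op(V)` and `A = A^×`. -/
def IsSymmetricOperator (S : BoundedMetric H) (A : S.Total →ₗ.[ℂ] S.Total) : Prop :=
  S.IsOperator A ∧ S.IsAdjointOperator A A

/-- The operator `A₀` in `H` is a restriction of `T : H_m → H_n`: every `ξ ∈ D(A₀)` lies in `H_m`,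
and `T ξ = A₀ ξ`. -/
def IsRestriction (S : BoundedMetric H) {m n : ℤ} (T : S.scale m →L[ℂ] S.scale n)
    (A₀ : H →ₗ.[ℂ] H) : Prop :=
  ∀ ξ : A₀.domain, ∃ f : S.scale m, (f : S.Total) = S.embed ξ ∧ (T f : S.Total) = S.embed (A₀ ξ)

end BoundedMetric

/-! ### Spectra of unbounded operators -/

section Spectra

variable {H : Type*} [NormedAddCommGroup H] [InnerProductSpace ℂ H]

/-- The resolvent set of `A`: those `z` for which `A - z : D(A) → H` has a bounded two-sided
inverse. -/
def opResolventSet (A : H →ₗ.[ℂ] H) : Set ℂ :=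
  {z | ∃ R : H →L[ℂ] H, (∀ η, ∃ h : R η ∈ A.domain, A ⟨R η, h⟩ - z • R η = η) ∧
    ∀ ξ : A.domain, R (A ξ - z • (ξ : H)) = ξ}

/-- The spectrum of `A`. -/
def opSpectrum (A : H →ₗ.[ℂ] H) : Set ℂ := (opResolventSet A)ᶜ

/-- The eigenspace `{ξ ∈ D(A) | A ξ = z ξ}`. -/
def opEigenspace (A : H →ₗ.[ℂ] H) (z : ℂ) : Submodule ℂ H :=
  (LinearMap.ker (A.toFun - z • A.domain.subtype)).map A.domain.subtype

/-- The point spectrum of `A`: the set of its eigenvalues. -/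
def opPointSpectrum (A : H →ₗ.[ℂ] H) : Set ℂ := {z | opEigenspace A z ≠ ⊥}

/-- The continuous spectrum of `A`: the `z` in the spectrum for which `A - z` is injective with
dense range. -/
def opContinuousSpectrum (A : H →ₗ.[ℂ] H) : Set ℂ :=
  {z ∈ opSpectrum A | opEigenspace A z = ⊥ ∧
    Dense (Set.range fun ξ : A.domain => A ξ - z • (ξ : H))}

end Spectra

end

/-!
In the coordinates `B^m : H_m → H` and `B^n : H_n → H`, where `B = C⁻¹`, the representative
`A_{nm}` becomes a bounded operator `t` in `H`, the natural embedding becomes `C^d` with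
`d = m - n`, and the inverse of `A_{nm} - λ E_{nm}` becomes a bounded operator `Q`. Symmetry of `A`
compares `A_{nm}` with its representative `H_{-n} → H_{-m}`, whose coordinate operator is `t*`; on
the smaller of the two domains it says that `C^{m+n} t`, hence also `C^{m+n} Q`, is symmetric (with
`C^{-(m+n)}` on the other side if `m + n < 0`).

The point is to show that `(A_{nm} - λ E_{nm})⁻¹` maps `H ⊆ H_n` into `H`, which is not immediate
since `H_m` need not be contained in `H` (take `n < m < 0`). This is where
`exists_isSelfAdjoint_mul_eq_of_symmetrized` enters, the theorem on symmetrizable operators: if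
`P² Q` is self-adjoint, then `Q` is bounded for the norm `‖P x‖`, so that `Y P = P Q` for some
bounded self-adjoint `Y`. With `P = C^{|m+n|/2}`, and `Q*` in place of `Q` if `m + n < 0`, the
operator `Y` is `C^{-d/2} (A - λ)⁻¹ C^{-d/2}`, and `R = C^{d/2} Y C^{d/2}` is a bounded
self-adjoint operator in `H` which is a restriction of `(A_{nm} - λ E_{nm})⁻¹`
(`BoundedMetric.exists_resolvent`). The square root `C^{1/2}` is needed because `m + n` may be odd. If the indices are in the wrong order, the
inclusions `H_m ⊆ H_n`, `H ⊆ H_n` force all spaces of the scale to coincide, and `m = n = 0` may be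
assumed.

The operator sought is `R⁻¹ + λ` (`LinearPMap.ofResolvent`). It is self-adjoint because `R` is, it
contains every restriction of `A_{nm}` to an operator in `H`, and this gives uniqueness since
self-adjoint operators have no proper self-adjoint extensions. If the embedding is compact, then
`C^d = (C^{d/2})* C^{d/2}` is compact, therefore `C^{d/2}` and `R` are compact, and the spectral
theorem and the Fredholm alternative for `R` give the second part.
-/

open scoped ComplexConjugate InnerProductSpace

/-! ### Symmetrizable operators and compactness -/

section Hilbert

variable {H : Type*} [NormedAddCommGroup H] [InnerProductSpace ℂ H] [CompleteSpace H]

lemma IsSelfAdjoint.inner_left_eq_right {P : H →L[ℂ] H} (hP : IsSelfAdjoint P) (x y : H) :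
    ⟪P x, y⟫_ℂ = ⟪x, P y⟫_ℂ :=
  ContinuousLinearMap.isSelfAdjoint_iff_isSymmetric.1 hP x y

lemma IsSelfAdjoint.denseRange_of_injective {P : H →L[ℂ] H} (hP : IsSelfAdjoint P)
    (hinj : Function.Injective P) : DenseRange P := by
  have h : (LinearMap.range (P : H →ₗ[ℂ] H)).topologicalClosure = ⊤ := by
    rw [Submodule.topologicalClosure_eq_top_iff, Submodule.eq_bot_iff]
    intro x hx
    rw [Submodule.mem_orthogonal] at hx
    apply hinj
    rw [map_zero, ← inner_self_eq_zero (𝕜 := ℂ), ← hP.inner_left_eq_right]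
    exact hx _ ⟨P x, rfl⟩
  exact Submodule.dense_iff_topologicalClosure_eq_top.2 h

/-- If `P² Q` is self-adjoint, i.e. if `Q` is symmetric for the form `⟪P x, P y⟫`, then so is every
power of `Q`. -/
lemma IsSelfAdjoint.symmetrized_pow {P Q : H →L[ℂ] H} (hP : IsSelfAdjoint P)
    (hPQ : IsSelfAdjoint (P * P * Q)) (j : ℕ) : IsSelfAdjoint (P * P * Q ^ j) := by
  have hPP : star (P * P) = P * P := by rw [star_mul, hP.star_eq]
  have h : SemiconjBy (P * P) Q (star Q) := by
    have := hPQ.star_eq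
    rw [star_mul, hPP] at this
    exact this.symm
  have h' := (h.pow_right j).eq
  rw [isSelfAdjoint_iff, star_mul, hPP, star_pow, ← h']

lemma norm_sq_le_of_symmetrized {P Q : H →L[ℂ] H} (hP : IsSelfAdjoint P)
    (hPQ : IsSelfAdjoint (P * P * Q)) (x : H) :
    ‖P (Q x)‖ ^ 2 ≤ ‖P (Q (Q x))‖ * ‖P x‖ := by
  have h : ⟪P (Q x), P (Q x)⟫_ℂ = ⟪P x, P (Q (Q x))⟫_ℂ := by
    rw [← hP.inner_left_eq_right, hP.inner_left_eq_right x]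
    exact hPQ.inner_left_eq_right x (Q x)
  rw [norm_sq_eq_re_inner (𝕜 := ℂ), h, mul_comm]
  exact re_inner_le_norm _ _

/-- A bounded operator which is symmetric for the weaker norm `‖P x‖` is bounded for that norm:
iterating the Cauchy-Schwarz estimate along the powers `Q ^ 2 ^ k` gives a geometric growth rate
which cannot exceed that of the powers of `Q` in the original norm. The summand `1` only keeps the
constant positive. -/
lemma norm_le_of_symmetrized {P Q : H →L[ℂ] H} (hP : IsSelfAdjoint P)
    (hinj : Function.Injective P) (hPQ : IsSelfAdjoint (P * P * Q)) (x : H) :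
    ‖P (Q x)‖ ≤ (‖Q‖ + 1) * ‖P x‖ := by
  rcases eq_or_ne x 0 with rfl | hx
  · simp
  have hp : 0 < ‖P x‖ := norm_pos_iff.2 fun h => hx (hinj (h.trans (map_zero P).symm))
  have hc : 0 < ‖Q‖ + 1 := by positivity
  have hgrow : ∀ k : ℕ, (‖P (Q x)‖ / ‖P x‖) ^ 2 ^ k ≤ ‖P ((Q ^ 2 ^ k) x)‖ / ‖P x‖ := by
    intro k
    induction k with
    | zero => simp
    | succ k ih =>
      have h1 := norm_sq_le_of_symmetrized hP (hP.symmetrized_pow hPQ (2 ^ k)) x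
      have h2 : (Q ^ 2 ^ (k + 1)) x = (Q ^ 2 ^ k) ((Q ^ 2 ^ k) x) := by
        rw [← mul_apply_eq_comp, ← pow_add, pow_succ, mul_two]
      rw [pow_succ 2 k, pow_mul, ← pow_succ, h2]
      refine (pow_le_pow_left₀ (by positivity) ih 2).trans ?_
      rw [div_pow, div_le_div_iff₀ (by positivity) hp]
      nlinarith
  by_contra! hlt
  have hone : 1 < ‖P (Q x)‖ / ‖P x‖ / (‖Q‖ + 1) := by
    rw [lt_div_iff₀ hc, lt_div_iff₀ hp, one_mul]
    exact hlt
  obtain ⟨N, hN⟩ := pow_unbounded_of_one_lt (‖P‖ * ‖x‖ / ‖P x‖) hone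
  have hN' := hN.trans_le (pow_le_pow_right₀ hone.le (Nat.lt_two_pow_self (n := N)).le)
  rw [div_pow, lt_div_iff₀ (by positivity)] at hN'
  refine hN'.not_ge ((hgrow N).trans ?_)
  rw [div_mul_eq_mul_div]
  gcongr
  calc ‖P ((Q ^ 2 ^ N) x)‖ ≤ ‖P‖ * (‖Q ^ 2 ^ N‖ * ‖x‖) :=
        P.le_opNorm_of_le ((Q ^ 2 ^ N).le_opNorm x)
    _ ≤ ‖P‖ * ((‖Q‖ + 1) ^ 2 ^ N * ‖x‖) := by
        gcongr
        exact (norm_pow_le' Q (by positivity)).trans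
          (pow_le_pow_left₀ (norm_nonneg _) (by linarith) _)
    _ = ‖P‖ * ‖x‖ * (‖Q‖ + 1) ^ 2 ^ N := by ring

/-- A symmetrizable operator `Q` induces a bounded self-adjoint operator `Y` on the completion of
`H` for the norm `‖P x‖`, here identified with `H` through `P`. -/
theorem exists_isSelfAdjoint_mul_eq_of_symmetrized {P Q : H →L[ℂ] H} (hP : IsSelfAdjoint P)
    (hinj : Function.Injective P) (hPQ : IsSelfAdjoint (P * P * Q)) :
    ∃ Y : H →L[ℂ] H, IsSelfAdjoint Y ∧ Y * P = P * Q := by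
  have hdense := hP.denseRange_of_injective hinj
  let Y : H →L[ℂ] H := (P * Q : H →L[ℂ] H).toLinearMap.extendOfNorm P.toLinearMap
  have hY : ∀ x, Y (P x) = P (Q x) := fun x =>
    LinearMap.extendOfNorm_eq hdense ⟨_, norm_le_of_symmetrized hP hinj hPQ⟩ x
  refine ⟨Y, ContinuousLinearMap.isSelfAdjoint_iff_isSymmetric.2 fun x y => ?_,
    ContinuousLinearMap.ext hY⟩
  change ⟪Y x, y⟫_ℂ = ⟪x, Y y⟫_ℂ
  refine hdense.induction_on₂ (p := fun x y => ⟪Y x, y⟫_ℂ = ⟪x, Y y⟫_ℂ)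
    (isClosed_eq (by fun_prop) (by fun_prop)) (fun a b => ?_) x y
  rw [hY, hY, ← hP.inner_left_eq_right, hP.inner_left_eq_right a]
  exact hPQ.inner_left_eq_right a b

/-- If `T* T` is compact, so is `T`. -/
lemma isCompactOperator_of_adjoint_mul_self {T : H →L[ℂ] H}
    (h : IsCompactOperator (star T * T)) : IsCompactOperator T := by
  refine (isCompactOperator_iff_isCompact_closure_image_closedBall T.toLinearMap one_pos).2 ?_
  refine TotallyBounded.isCompact_of_isClosed (TotallyBounded.closure ?_) isClosed_closure
  have hK : TotallyBounded ((star T * T) '' Metric.closedBall (0 : H) 1) :=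
    (h.isCompact_closure_image_closedBall (f := (star T * T).toLinearMap) 1).totallyBounded.subset
      subset_closure
  rw [Metric.totallyBounded_iff]
  intro ε hε
  obtain ⟨t, htK, htf, hcov⟩ :=
    Metric.finite_approx_of_totallyBounded hK (ε ^ 2 / 2) (by positivity)
  obtain ⟨t', ht'B, ht'f, rfl⟩ : ∃ t' ⊆ Metric.closedBall (0 : H) 1, t'.Finite ∧
      (star T * T) '' t' = t := by
    obtain ⟨t', h1, h2, h3⟩ :=
      Set.exists_subset_image_finite_and (p := (· = t)).1 ⟨t, htK, htf, rfl⟩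
    exact ⟨t', h1, h2, h3⟩
  refine ⟨T '' t', ht'f.image T, ?_⟩
  rintro _ ⟨x, hx, rfl⟩
  have hx' := hcov ⟨x, hx, rfl⟩
  simp only [Set.mem_iUnion, Set.mem_image, exists_prop, Metric.mem_ball] at hx' ⊢
  obtain ⟨_, ⟨y, hy, rfl⟩, hxy⟩ := hx'
  refine ⟨_, ⟨y, hy, rfl⟩, ?_⟩
  have hy1 := ht'B hy
  rw [mem_closedBall_zero_iff] at hx hy1
  rw [dist_eq_norm, ← map_sub] at hxy
  change dist (T x) (T y) < ε
  rw [dist_eq_norm, ← map_sub]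
  have h1 : ‖T (x - y)‖ ^ 2 ≤ ‖(star T * T) (x - y)‖ * ‖x - y‖ := by
    rw [norm_sq_eq_re_inner (𝕜 := ℂ), ← ContinuousLinearMap.adjoint_inner_left]
    exact re_inner_le_norm _ _
  have h2 : ‖x - y‖ ≤ 2 := (norm_sub_le x y).trans (by linarith)
  refine lt_of_pow_lt_pow_left₀ 2 hε.le (h1.trans_lt ?_)
  nlinarith [norm_nonneg (x - y), norm_nonneg ((star T * T) (x - y))]

end Hilbert

/-! ### The self-adjoint operator with a given resolvent -/

section Resolvent

variable {H : Type*} [NormedAddCommGroup H] [InnerProductSpace ℂ H]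

/-- The operator `R⁻¹ + z` with domain the range of the injective operator `R`, so that `R` is its
resolvent at `z`. -/
noncomputable def LinearPMap.ofResolvent (R : H →L[ℂ] H) (hR : Function.Injective R) (z : ℂ) :
    H →ₗ.[ℂ] H where
  domain := LinearMap.range (R : H →ₗ[ℂ] H)
  toFun := (LinearEquiv.ofInjective (R : H →ₗ[ℂ] H) hR).symm.toLinearMap +
    z • (LinearMap.range (R : H →ₗ[ℂ] H)).subtype

namespace LinearPMap

variable {R : H →L[ℂ] H} {hR : Function.Injective R} {z : ℂ}

lemma mem_ofResolvent_domain (η : H) : R η ∈ (ofResolvent R hR z).domain := ⟨η, rfl⟩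

lemma ofResolvent_apply (η : H) :
    ofResolvent R hR z ⟨R η, mem_ofResolvent_domain η⟩ = η + z • R η := by
  have h : (LinearEquiv.ofInjective (R : H →ₗ[ℂ] H) hR).symm ⟨R η, η, rfl⟩ = η :=
    (LinearEquiv.ofInjective (R : H →ₗ[ℂ] H) hR).symm_apply_apply η
  change (LinearEquiv.ofInjective (R : H →ₗ[ℂ] H) hR).symm ⟨R η, η, rfl⟩ + z • R η = _
  rw [h]

lemma apply_resolvent_ofResolvent (ξ : (ofResolvent R hR z).domain) :
    R (ofResolvent R hR z ξ - z • (ξ : H)) = ξ := by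
  obtain ⟨_, η, rfl⟩ := ξ
  change R (ofResolvent R hR z ⟨R η, mem_ofResolvent_domain η⟩ - z • R η) = R η
  rw [ofResolvent_apply, add_sub_cancel_right]

lemma mem_opResolventSet_ofResolvent : z ∈ opResolventSet (ofResolvent R hR z) :=
  ⟨R, fun η => ⟨mem_ofResolvent_domain η, by rw [ofResolvent_apply, add_sub_cancel_right]⟩,
    apply_resolvent_ofResolvent⟩

/-- Two self-adjoint operators one of which extends the other are equal. -/
lemma eq_of_isSelfAdjoint_of_le [CompleteSpace H] {A B : H →ₗ.[ℂ] H} (hA : IsSelfAdjoint A)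
    (hB : IsSelfAdjoint B) (h : A ≤ B) : A = B := by
  refine le_antisymm h ?_
  have hBA : A.IsFormalAdjoint B := fun x y => by
    have h1 := adjoint_isFormalAdjoint hB.dense_domain
    rw [isSelfAdjoint_def.1 hB] at h1
    have h2 : A x = B ⟨x, h.1 x.2⟩ := h.2 rfl
    rw [h2]
    exact h1 ⟨x, h.1 x.2⟩ y
  have := hBA.le_adjoint hA.dense_domain
  rwa [isSelfAdjoint_def.1 hA] at this

/-- If the resolvent at one real point is self-adjoint, so is the operator. -/
lemma isSelfAdjoint_ofResolvent [CompleteSpace H] (hsa : IsSelfAdjoint R) (r : ℝ) :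
    IsSelfAdjoint (ofResolvent R hR r) := by
  have hdense : Dense ((ofResolvent R hR r).domain : Set H) := hsa.denseRange_of_injective hR
  have hformal : (ofResolvent R hR r).IsFormalAdjoint (ofResolvent R hR r) := by
    rintro ⟨_, x, rfl⟩ ⟨_, y, rfl⟩
    change ⟪ofResolvent R hR r ⟨R x, mem_ofResolvent_domain x⟩, R y⟫_ℂ =
      ⟪R x, ofResolvent R hR r ⟨R y, mem_ofResolvent_domain y⟩⟫_ℂ
    rw [ofResolvent_apply, ofResolvent_apply, inner_add_left, inner_add_right, inner_smul_left,
      inner_smul_right, Complex.conj_ofReal, hsa.inner_left_eq_right x y]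
  rw [isSelfAdjoint_def]
  refine (eq_of_le_of_domain_eq (hformal.le_adjoint hdense) (le_antisymm
    (hformal.le_adjoint hdense).1 fun η hη => ?_)).symm
  -- a vector `η` in the domain of the adjoint is the value of the resolvent at `A* η - r η`.
  refine ⟨(ofResolvent R hR r).adjoint ⟨η, hη⟩ - (r : ℂ) • η, ?_⟩
  refine ext_inner_right ℂ fun x => ?_
  have h := adjoint_isFormalAdjoint hdense ⟨η, hη⟩ ⟨R x, mem_ofResolvent_domain x⟩
  rw [ofResolvent_apply] at h
  change ⟪R _, x⟫_ℂ = _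
  rw [hsa.inner_left_eq_right, inner_sub_left, h, inner_add_right, inner_smul_left,
    inner_smul_right, Complex.conj_ofReal, add_sub_cancel_right]

lemma mem_opEigenspace {A : H →ₗ.[ℂ] H} {w : ℂ} {ξ : H} :
    ξ ∈ opEigenspace A w ↔ ∃ h : ξ ∈ A.domain, A ⟨ξ, h⟩ = w • ξ := by
  simp only [opEigenspace, Submodule.mem_map, LinearMap.mem_ker, LinearMap.sub_apply,
    LinearMap.smul_apply, sub_eq_zero, Submodule.subtype_apply]
  constructor
  · rintro ⟨x, hx, rfl⟩
    exact ⟨x.2, hx⟩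
  · rintro ⟨h, hx⟩
    exact ⟨⟨ξ, h⟩, hx, rfl⟩

/-- For `w ≠ z`, the eigenvectors of the operator for the eigenvalue `w` are those of its resolvent
at `z` for the eigenvalue `(w - z)⁻¹`. -/
lemma opEigenspace_ofResolvent {w : ℂ} (hw : w ≠ z) :
    opEigenspace (ofResolvent R hR z) w =
      Module.End.eigenspace (R : Module.End ℂ H) (w - z)⁻¹ := by
  have hwz : w - z ≠ 0 := sub_ne_zero.2 hw
  ext ξ
  rw [mem_opEigenspace, Module.End.mem_eigenspace_iff]
  constructor
  · rintro ⟨h, hξ⟩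
    have h1 := apply_resolvent_ofResolvent ⟨ξ, h⟩
    rw [hξ, ← sub_smul, _root_.map_smul] at h1
    rw [eq_inv_smul_iff₀ hwz]
    exact h1
  · intro h
    rw [eq_inv_smul_iff₀ hwz] at h
    have h1 : R ((w - z) • ξ) = ξ := (_root_.map_smul R _ _).trans h
    have h2 := ofResolvent_apply (hR := hR) (z := z) ((w - z) • ξ)
    simp only [h1] at h2
    exact ⟨h1 ▸ mem_ofResolvent_domain _, by rw [h2, ← add_smul, sub_add_cancel]⟩

lemma notMem_opResolventSet_of_mem_opPointSpectrum {A : H →ₗ.[ℂ] H} {w : ℂ}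
    (hw : w ∈ opPointSpectrum A) : w ∉ opResolventSet A := by
  rintro ⟨B, -, hB⟩
  obtain ⟨ξ, hξ, hξ0⟩ := Submodule.exists_mem_ne_zero_of_ne_bot hw
  obtain ⟨h, hξ⟩ := mem_opEigenspace.1 hξ
  have := hB ⟨ξ, h⟩
  rw [hξ, sub_self, _root_.map_zero] at this
  exact hξ0 this.symm

/-- The first resolvent identity, used as a construction: if `(w - z)⁻¹` is in the resolvent set of
the resolvent at `z`, then `w` is in the resolvent set of the operator. -/
lemma mem_opResolventSet_ofResolvent_of_inv {w : ℂ} (hw : w ≠ z)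
    (h : (w - z)⁻¹ ∈ resolventSet ℂ R) : w ∈ opResolventSet (ofResolvent R hR z) := by
  have hwz : w - z ≠ 0 := sub_ne_zero.2 hw
  obtain ⟨u, hu⟩ := spectrum.mem_resolventSet_iff.1 h
  have hu' : ∀ x, (u : H →L[ℂ] H) x = (w - z)⁻¹ • x - R x := fun x => by
    rw [hu, _root_.sub_apply, ContinuousLinearMap.algebraMap_apply]
  -- the resolvent at `w` is `R (1 - (w - z) R)⁻¹`
  let W : H →L[ℂ] H := (w - z)⁻¹ • (↑u⁻¹ : H →L[ℂ] H)
  have hW1 : ∀ x, W x - (w - z) • R (W x) = x := fun x => by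
    have h1 : (u : H →L[ℂ] H) ((↑u⁻¹ : H →L[ℂ] H) x) = x := by
      rw [← mul_apply_eq_comp, u.mul_inv]; rfl
    rw [hu'] at h1
    change (w - z)⁻¹ • (↑u⁻¹ : H →L[ℂ] H) x -
      (w - z) • R ((w - z)⁻¹ • (↑u⁻¹ : H →L[ℂ] H) x) = x
    rw [_root_.map_smul, smul_inv_smul₀ hwz, h1]
  have hW2 : ∀ x, W (x - (w - z) • R x) = x := fun x => by
    have h1 : (↑u⁻¹ : H →L[ℂ] H) ((u : H →L[ℂ] H) x) = x := by
      rw [← mul_apply_eq_comp, u.inv_mul]; rfl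
    have h2 : x - (w - z) • R x = (w - z) • (u : H →L[ℂ] H) x := by
      rw [hu', smul_sub, smul_inv_smul₀ hwz]
    change (w - z)⁻¹ • (↑u⁻¹ : H →L[ℂ] H) _ = x
    rw [h2, _root_.map_smul, h1, inv_smul_smul₀ hwz]
  refine ⟨R * W, fun η => ⟨mem_ofResolvent_domain _, ?_⟩, ?_⟩
  · change ofResolvent R hR z ⟨R (W η), _⟩ - w • R (W η) = η
    rw [ofResolvent_apply]
    conv_rhs => rw [← hW1 η]
    rw [sub_smul]
    abel
  · rintro ⟨_, x, rfl⟩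
    change R (W (ofResolvent R hR z ⟨R x, _⟩ - w • R x)) = R x
    rw [ofResolvent_apply]
    congr 1
    conv_rhs => rw [← hW2 x]
    rw [sub_smul]
    congr 1
    abel

variable [CompleteSpace H]

/-- If a resolvent is compact, every point of the spectrum is an eigenvalue. -/
lemma opSpectrum_ofResolvent_eq_opPointSpectrum (hc : IsCompactOperator R) :
    opSpectrum (ofResolvent R hR z) = opPointSpectrum (ofResolvent R hR z) := by
  refine Set.Subset.antisymm (fun w hw => ?_) fun w hw =>
    notMem_opResolventSet_of_mem_opPointSpectrum hw
  have hwz : w ≠ z := by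
    rintro rfl
    exact hw mem_opResolventSet_ofResolvent
  change opEigenspace _ w ≠ ⊥
  rw [opEigenspace_ofResolvent hwz]
  exact (hc.hasEigenvalue_or_mem_resolventSet (inv_ne_zero (sub_ne_zero.2 hwz))).resolve_right
    fun h => hw (mem_opResolventSet_ofResolvent_of_inv hwz h)

lemma finiteDimensional_opEigenspace_ofResolvent (hc : IsCompactOperator R) {w : ℂ}
    (hw : w ∈ opPointSpectrum (ofResolvent R hR z)) :
    FiniteDimensional ℂ (opEigenspace (ofResolvent R hR z) w) := by
  have hwz : w ≠ z := by
    rintro rfl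
    exact notMem_opResolventSet_of_mem_opPointSpectrum hw mem_opResolventSet_ofResolvent
  rw [opEigenspace_ofResolvent hwz]
  exact ContinuousLinearMap.finite_dimensional_eigenspace hc _ (inv_ne_zero (sub_ne_zero.2 hwz))

/-- The spectral theorem for the compact self-adjoint resolvent; its kernel is trivial, so that only
its nonzero eigenvalues, which come from eigenvalues of the operator, contribute. -/
lemma topologicalClosure_iSup_opEigenspace_ofResolvent (hsa : IsSelfAdjoint R)
    (hc : IsCompactOperator R) :
    (⨆ w, opEigenspace (ofResolvent R hR z) w).topologicalClosure = ⊤ := by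
  rw [Submodule.topologicalClosure_eq_top_iff, eq_bot_iff,
    ← ContinuousLinearMap.orthogonalComplement_iSup_eigenspaces_eq_bot hc
      (ContinuousLinearMap.isSelfAdjoint_iff_isSymmetric.1 hsa)]
  refine Submodule.orthogonal_le (iSup_le fun μ => ?_)
  rcases eq_or_ne μ 0 with rfl | hμ
  · intro x hx
    rw [Module.End.mem_eigenspace_iff, zero_smul] at hx
    rw [hR (hx.trans (_root_.map_zero R).symm)]
    exact zero_mem _
  · have h : z + μ⁻¹ ≠ z := by simpa using hμ
    have h' := opEigenspace_ofResolvent (R := R) (hR := hR) h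
    rw [add_sub_cancel_left, inv_inv] at h'
    rw [← h']
    exact le_iSup (opEigenspace (ofResolvent R hR z)) (z + μ⁻¹)

end LinearPMap

lemma opContinuousSpectrum_eq_empty {A : H →ₗ.[ℂ] H} (h : opSpectrum A = opPointSpectrum A) :
    opContinuousSpectrum A = ∅ := by
  rw [Set.eq_empty_iff_forall_notMem]
  rintro w ⟨hw, hbot, -⟩
  rw [h] at hw
  exact hw hbot

end Resolvent

/-! ### Coordinates in the Hilbert scale -/

namespace BoundedMetric

variable {H : Type*} [NormedAddCommGroup H] [InnerProductSpace ℂ H] [CompleteSpace H]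
  (S : BoundedMetric H)

lemma negPow_eq_of_eq_add {a b : ℤ} {k : ℕ} (h : b = a + k) (x : H) :
    S.negPow b x = S.negPow a ((S.root ^ k) x) := by
  refine S.eval_ext fun φ => ?_
  have h1 : S.corePow b φ = S.corePow k (S.corePow a φ) := by
    rw [h, add_comm, corePow, zpow_add]
    rfl
  rw [eval_negPow, eval_negPow, h1, coe_corePow_natCast, inner_root_pow]

lemma scale_le_scale {a b : ℤ} (h : a ≤ b) : S.scale b ≤ S.scale a := by
  obtain ⟨k, hk⟩ := Int.le.dest h
  rintro _ ⟨x, rfl⟩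
  exact ⟨_, (S.negPow_eq_of_eq_add hk.symm x).symm⟩

/-- A strict inclusion of indices in the wrong direction forces the scale to collapse: `B` is then
bounded, and all the spaces coincide as vector spaces. -/
lemma scale_le_scale_of_lt_of_le {a b : ℤ} (hab : a < b) (h : S.scale a ≤ S.scale b) (c d : ℤ) :
    S.scale c ≤ S.scale d := by
  obtain ⟨k, hk⟩ := Int.le.dest (Int.add_one_le_of_lt hab)
  have hsurj : Function.Surjective S.root := by
    intro x
    obtain ⟨y, hy⟩ := h ⟨x, rfl⟩
    rw [S.negPow_eq_of_eq_add (a := a) (k := k + 1) (by push_cast; omega) y] at hy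
    refine ⟨(S.root ^ k) y, ?_⟩
    rw [← mul_apply_eq_comp, ← pow_succ']
    exact S.negPow_injective a hy
  have hsurj' : ∀ j : ℕ, Function.Surjective (S.root ^ j) := by
    intro j
    induction j with
    | zero => exact fun x => ⟨x, rfl⟩
    | succ j ih =>
      rw [pow_succ]
      exact ih.comp hsurj
  rcases le_total d c with hdc | hcd
  · exact S.scale_le_scale hdc
  · obtain ⟨j, hj⟩ := Int.le.dest hcd
    rintro _ ⟨x, rfl⟩
    obtain ⟨y, rfl⟩ := hsurj' j x
    exact ⟨y, S.negPow_eq_of_eq_add hj.symm y⟩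

lemma coord_eq_of_coe_eq_negPow {n : ℤ} {f : S.scale n} {x : H} (h : (f : S.Total) = S.negPow n x) :
    S.coord n f = x :=
  S.negPow_injective n ((S.negPow_coord n f).trans h)

lemma coe_coordIsometry_symm (n : ℤ) (x : H) :
    ((S.coordIsometry n).symm x : S.Total) = S.negPow n x := by
  rw [← S.negPow_coord]
  exact congrArg _ ((S.coordIsometry n).apply_symm_apply x)

variable {S}

/-- The operator `B^n T B^{-m}` in `H` which represents `T : H_m → H_n`. -/
noncomputable def coordOp {m n : ℤ} (T : S.scale m →L[ℂ] S.scale n) : H →L[ℂ] H :=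
  ((S.coordIsometry n : S.scale n →L[ℂ] H) ∘L T) ∘L ((S.coordIsometry m).symm : H →L[ℂ] S.scale m)

lemma coordOp_apply {m n : ℤ} (T : S.scale m →L[ℂ] S.scale n) (x : H) :
    coordOp T x = S.coord n (T ((S.coordIsometry m).symm x)) := rfl

lemma coe_apply_eq_negPow_coordOp {m n : ℤ} (T : S.scale m →L[ℂ] S.scale n) (f : S.scale m) :
    (T f : S.Total) = S.negPow n (coordOp T (S.coord m f)) := by
  rw [← S.negPow_coord, coordOp_apply]
  congr 3
  exact ((S.coordIsometry m).symm_apply_apply f).symm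

lemma coordOp_inclusion {m n : ℤ} {d : ℕ} (hd : m = n + d) (hmn : S.scale m ≤ S.scale n) :
    coordOp (S.inclusion hmn) = S.root ^ d := by
  ext x
  rw [coordOp_apply]
  apply S.coord_eq_of_coe_eq_negPow
  rw [← S.negPow_eq_of_eq_add hd]
  exact S.coe_coordIsometry_symm m x

lemma isCompactOperator_coordOp {m n : ℤ} {T : S.scale m →L[ℂ] S.scale n}
    (hT : IsCompactOperator T) : IsCompactOperator (coordOp T) :=
  (hT.clm_comp (S.coordIsometry n : S.scale n →L[ℂ] H)).comp_clm
    ((S.coordIsometry m).symm : H →L[ℂ] S.scale m)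

/-- Mutually adjoint representatives have mutually adjoint coordinate operators. -/
lemma coordOp_eq_star {m n : ℤ} {T : S.scale m →L[ℂ] S.scale n}
    {T' : S.scale (-n) →L[ℂ] S.scale (-m)}
    (h : ∀ (f : S.scale m) (g : S.scale (-n)),
      S.pairing (neg_add_cancel m) (T' g) f = S.pairing (neg_add_cancel n) g (T f)) :
    coordOp T' = star (coordOp T) := by
  rw [ContinuousLinearMap.star_eq_adjoint, ContinuousLinearMap.eq_adjoint_iff]
  intro x y
  have := h ((S.coordIsometry m).symm y) ((S.coordIsometry (-n)).symm x)
  simp only [pairing] at this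
  have h1 : S.coord m ((S.coordIsometry m).symm y) = y := (S.coordIsometry m).apply_symm_apply y
  have h2 : S.coord (-n) ((S.coordIsometry (-n)).symm x) = x :=
    (S.coordIsometry (-n)).apply_symm_apply x
  rw [h1, h2] at this
  exact this

lemma IsRepresentative.coe_apply_eq {A : S.Total →ₗ.[ℂ] S.Total} {m n m' n' : ℤ}
    {T : S.scale m →L[ℂ] S.scale n} {T' : S.scale m' →L[ℂ] S.scale n'}
    (hT : S.IsRepresentative A T) (hT' : S.IsRepresentative A T') {f : S.scale m}
    {g : S.scale m'} (hfg : (f : S.Total) = g) : (T f : S.Total) = T' g := by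
  obtain ⟨hf, h1⟩ := hT f
  obtain ⟨hg, h2⟩ := hT' g
  rw [← h1, ← h2]
  congr 1
  exact Subtype.ext hfg

lemma IsRepresentative.negPow_coordOp_eq {A : S.Total →ₗ.[ℂ] S.Total} {m n m' n' : ℤ}
    {T : S.scale m →L[ℂ] S.scale n} {T' : S.scale m' →L[ℂ] S.scale n'}
    (hT : S.IsRepresentative A T) (hT' : S.IsRepresentative A T') {x y : H}
    (hxy : S.negPow m x = S.negPow m' y) :
    S.negPow n (coordOp T x) = S.negPow n' (coordOp T' y) := by
  have h := hT.coe_apply_eq hT' (f := (S.coordIsometry m).symm x)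
    (g := (S.coordIsometry m').symm y) (by simpa only [coe_coordIsometry_symm] using hxy)
  rw [coordOp_apply, coordOp_apply, negPow_coord, negPow_coord]
  exact h

/-- For `m + n = k ≥ 0`, symmetry of `A : H_m → H_n` in coordinates: `C^k t` is self-adjoint. -/
lemma IsAdjointOperator.root_pow_mul_coordOp {A : S.Total →ₗ.[ℂ] S.Total}
    (hA : S.IsAdjointOperator A A) {m n : ℤ} {k : ℕ} (hk : m + n = k)
    {T : S.scale m →L[ℂ] S.scale n} (hT : S.IsRepresentative A T) :
    S.root ^ k * coordOp T = star (coordOp T) * S.root ^ k := by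
  obtain ⟨T', hT', hTT'⟩ := hA m n T hT
  rw [← coordOp_eq_star hTT']
  ext x
  apply S.negPow_injective (-m)
  have h := hT.negPow_coordOp_eq hT' (S.negPow_eq_of_eq_add (a := -n) (k := k) (by omega) x)
  rw [S.negPow_eq_of_eq_add (a := -m) (k := k) (by omega)] at h
  exact h

/-- For `m + n = -k ≤ 0`, symmetry of `A : H_m → H_n` in coordinates: `t C^k` is self-adjoint. -/
lemma IsAdjointOperator.coordOp_mul_root_pow {A : S.Total →ₗ.[ℂ] S.Total}
    (hA : S.IsAdjointOperator A A) {m n : ℤ} {k : ℕ} (hk : m + n = -k)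
    {T : S.scale m →L[ℂ] S.scale n} (hT : S.IsRepresentative A T) :
    coordOp T * S.root ^ k = S.root ^ k * star (coordOp T) := by
  obtain ⟨T', hT', hTT'⟩ := hA m n T hT
  rw [← coordOp_eq_star hTT']
  ext x
  apply S.negPow_injective n
  have h := hT'.negPow_coordOp_eq hT (S.negPow_eq_of_eq_add (a := m) (k := k) (by omega) x)
  rw [S.negPow_eq_of_eq_add (a := n) (k := k) (by omega)] at h
  exact h.symm

lemma coordOp_sub_smul {m n : ℤ} (T E : S.scale m →L[ℂ] S.scale n) (c : ℂ) :
    coordOp (T - c • E) = coordOp T - c • coordOp E := by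
  ext x
  simp [coordOp_apply]

lemma coordOp_mul_coordOp_symm {m n : ℤ} (e : S.scale m ≃L[ℂ] S.scale n) :
    coordOp (e : S.scale m →L[ℂ] S.scale n) * coordOp (e.symm : S.scale n →L[ℂ] S.scale m) = 1 := by
  ext x
  simp [coordOp]

lemma coordOp_symm_mul_coordOp {m n : ℤ} (e : S.scale m ≃L[ℂ] S.scale n) :
    coordOp (e.symm : S.scale n →L[ℂ] S.scale m) * coordOp (e : S.scale m →L[ℂ] S.scale n) = 1 := by
  ext x
  simp [coordOp]

variable (S)

/-- The operator `D = C^{1/2} = B^{-1/2}`, which interpolates between consecutive spaces of the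
scale. -/
noncomputable def sqrtRoot : H →L[ℂ] H := CFC.sqrt S.root

lemma sqrtRoot_mul_self : S.sqrtRoot * S.sqrtRoot = S.root :=
  CFC.sqrt_mul_sqrt_self S.root S.root_nonneg

lemma sqrtRoot_pow_mul_pow (k : ℕ) : S.sqrtRoot ^ k * S.sqrtRoot ^ k = S.root ^ k := by
  rw [← pow_add, ← two_mul, pow_mul, sq, sqrtRoot_mul_self]

lemma isSelfAdjoint_sqrtRoot_pow (k : ℕ) : IsSelfAdjoint (S.sqrtRoot ^ k) :=
  (IsSelfAdjoint.of_nonneg (CFC.sqrt_nonneg S.root)).pow k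

lemma sqrtRoot_pow_injective (k : ℕ) : Function.Injective (S.sqrtRoot ^ k) := by
  have h : Function.Injective S.sqrtRoot := fun x y hxy => S.root_injective <| by
    rw [← S.sqrtRoot_mul_self, mul_apply_eq_comp, mul_apply_eq_comp, hxy]
  induction k with
  | zero => exact fun x y h => h
  | succ k ih =>
    rw [pow_succ]
    exact ih.comp h

end BoundedMetric

/-! ### The resolvent in the central Hilbert space -/

namespace BoundedMetric

variable {H : Type*} [NormedAddCommGroup H] [InnerProductSpace ℂ H] [CompleteSpace H]
  {S : BoundedMetric H}

/-- A symmetric resolvent `H_n → H_m`, `n ≤ m`, maps `H` into itself, even if `H_m ⊄ H`: in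
coordinates it is symmetrizable, hence `C^{-d/2} (A - λ)⁻¹ C^{-d/2}` with `d = m - n` extends to a
bounded self-adjoint operator `Y` in `H`, and `R = C^{d/2} Y C^{d/2}` is the restriction sought. -/
theorem exists_resolvent_of_le {A : S.Total →ₗ.[ℂ] S.Total} (hA : S.IsAdjointOperator A A)
    {m n : ℤ} (hle : n ≤ m) (hn : n ≤ 0) (hmn : S.scale m ≤ S.scale n) {r : ℝ}
    {T : S.scale m →L[ℂ] S.scale n} (hT : S.IsRepresentative A T) (e : S.scale m ≃L[ℂ] S.scale n)
    (he : (e : S.scale m →L[ℂ] S.scale n) = T - (r : ℂ) • S.inclusion hmn) :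
    ∃ R : H →L[ℂ] H, IsSelfAdjoint R ∧
      (∀ (η : H) (g : S.scale n), (g : S.Total) = S.embed η →
        (e.symm g : S.Total) = S.embed (R η)) ∧
      (IsCompactOperator (S.inclusion hmn) → IsCompactOperator R) := by
  obtain ⟨d, hd⟩ : ∃ d : ℕ, m = n + d := ⟨(m - n).toNat, by omega⟩
  obtain ⟨j, hj⟩ : ∃ j : ℕ, 0 = n + j := ⟨(-n).toNat, by omega⟩
  set t := coordOp T
  set q := coordOp (e : S.scale m →L[ℂ] S.scale n) with hq
  set Q := coordOp (e.symm : S.scale n →L[ℂ] S.scale m) with hQ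
  have hqQ : q * Q = 1 := coordOp_mul_coordOp_symm e
  have hQq : Q * q = 1 := coordOp_symm_mul_coordOp e
  have hqt : q = t - (r : ℂ) • S.root ^ d := by
    rw [hq, he, coordOp_sub_smul, coordOp_inclusion hd]
  have hqt' : star q = star t - (r : ℂ) • S.root ^ d := by
    rw [hqt, star_sub, star_smul, (S.root_selfAdjoint.pow d).star_eq]
    simp
  have hroot : ∀ k : ℕ, star (S.root ^ k) = S.root ^ k := fun k =>
    (S.root_selfAdjoint.pow k).star_eq
  have hcoord : ∀ (η : H) (g : S.scale n), (g : S.Total) = S.embed η →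
      (e.symm g : S.Total) = S.negPow m (Q ((S.root ^ j) η)) := by
    intro η g hg
    have h := coe_apply_eq_negPow_coordOp (e.symm : S.scale n →L[ℂ] S.scale m) g
    rwa [S.coord_eq_of_coe_eq_negPow (hg.trans (S.negPow_eq_of_eq_add hj η))] at h
  -- the natural embedding is `C^d = (D^d)* D^d`, so its compactness passes to `D^d`
  have hfactor : ∀ Y : H →L[ℂ] H, IsSelfAdjoint Y →
      IsSelfAdjoint (S.sqrtRoot ^ d * Y * S.sqrtRoot ^ d) ∧
      (IsCompactOperator (S.inclusion hmn) →
        IsCompactOperator (S.sqrtRoot ^ d * Y * S.sqrtRoot ^ d : H →L[ℂ] H)) := by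
    refine fun Y hY => ⟨?_, fun hc => ?_⟩
    · rw [isSelfAdjoint_iff, star_mul, star_mul, hY.star_eq,
        (S.isSelfAdjoint_sqrtRoot_pow d).star_eq, mul_assoc]
    · have h1 : IsCompactOperator (star (S.sqrtRoot ^ d) * S.sqrtRoot ^ d : H →L[ℂ] H) := by
        rw [(S.isSelfAdjoint_sqrtRoot_pow d).star_eq, S.sqrtRoot_pow_mul_pow,
          ← coordOp_inclusion hd hmn]
        exact isCompactOperator_coordOp hc
      exact (isCompactOperator_of_adjoint_mul_self h1).clm_comp (S.sqrtRoot ^ d * Y)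
  -- for `m + n < 0` it is `Q*` instead of `Q` which is symmetrized
  rcases le_total 0 (m + n) with hk | hk
  · obtain ⟨k, hk⟩ := Int.eq_ofNat_of_zero_le hk
    obtain ⟨μ, hμ⟩ : ∃ μ : ℕ, m = 0 + μ := ⟨m.toNat, by omega⟩
    have hsymm : S.root ^ k * q = star q * S.root ^ k := by
      rw [hqt', hqt, mul_sub, sub_mul, hA.root_pow_mul_coordOp hk hT, mul_smul_comm,
        smul_mul_assoc, ← pow_add, ← pow_add, add_comm]
    have hsa : IsSelfAdjoint (S.sqrtRoot ^ k * S.sqrtRoot ^ k * Q) := by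
      rw [S.sqrtRoot_pow_mul_pow, isSelfAdjoint_iff, star_mul, hroot]
      calc star Q * S.root ^ k = star Q * (S.root ^ k * q) * Q := by
            rw [mul_assoc, mul_assoc, hqQ, mul_one]
        _ = star (q * Q) * S.root ^ k * Q := by rw [hsymm, star_mul]; simp only [mul_assoc]
        _ = S.root ^ k * Q := by rw [hqQ, star_one, one_mul]
    obtain ⟨Y, hY, hYP⟩ := exists_isSelfAdjoint_mul_eq_of_symmetrized
      (S.isSelfAdjoint_sqrtRoot_pow k) (S.sqrtRoot_pow_injective k) hsa
    refine ⟨_, (hfactor Y hY).1, fun η g hg => ?_, (hfactor Y hY).2⟩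
    rw [hcoord η g hg, S.negPow_eq_of_eq_add hμ, embed]
    have hR : S.sqrtRoot ^ d * Y * S.sqrtRoot ^ d = S.root ^ μ * Q * S.root ^ j := by
      calc S.sqrtRoot ^ d * Y * S.sqrtRoot ^ d
          = S.sqrtRoot ^ d * (Y * S.sqrtRoot ^ k) * (S.sqrtRoot ^ j * S.sqrtRoot ^ j) := by
            rw [show d = k + (j + j) by omega, pow_add _ k, pow_add _ j]
            simp only [mul_assoc]
        _ = (S.sqrtRoot ^ d * S.sqrtRoot ^ k) * Q * S.root ^ j := by
            rw [hYP, S.sqrtRoot_pow_mul_pow]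
            simp only [mul_assoc]
        _ = S.root ^ μ * Q * S.root ^ j := by
            rw [← pow_add, show d + k = μ + μ by omega, pow_add, S.sqrtRoot_pow_mul_pow]
    rw [hR]
    rfl
  · obtain ⟨k, hk⟩ : ∃ k : ℕ, m + n = -k := ⟨(-(m + n)).toNat, by omega⟩
    have hsymm : q * S.root ^ k = S.root ^ k * star q := by
      rw [hqt', hqt, mul_sub, sub_mul, hA.coordOp_mul_root_pow hk hT, mul_smul_comm,
        smul_mul_assoc, ← pow_add, ← pow_add, add_comm d]
    have hsa : IsSelfAdjoint (S.sqrtRoot ^ k * S.sqrtRoot ^ k * star Q) := by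
      rw [S.sqrtRoot_pow_mul_pow, isSelfAdjoint_iff, star_mul, star_star, hroot]
      calc Q * S.root ^ k = Q * (S.root ^ k * star q) * star Q := by
            rw [mul_assoc, mul_assoc, ← star_mul, hQq, star_one, mul_one]
        _ = (Q * q) * S.root ^ k * star Q := by rw [← hsymm]; simp only [mul_assoc]
        _ = S.root ^ k * star Q := by rw [hQq, one_mul]
    obtain ⟨Y, hY, hYP⟩ := exists_isSelfAdjoint_mul_eq_of_symmetrized
      (S.isSelfAdjoint_sqrtRoot_pow k) (S.sqrtRoot_pow_injective k) hsa
    have hPY : S.sqrtRoot ^ k * Y = Q * S.sqrtRoot ^ k := by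
      have := congrArg star hYP
      rwa [star_mul, star_mul, star_star, hY.star_eq,
        (S.isSelfAdjoint_sqrtRoot_pow k).star_eq] at this
    have hPYD : S.sqrtRoot ^ k * Y * S.sqrtRoot ^ d = Q * S.root ^ j := by
      rw [hPY, mul_assoc, ← pow_add, show k + d = j + j by omega, pow_add, S.sqrtRoot_pow_mul_pow]
    refine ⟨_, (hfactor Y hY).1, fun η g hg => ?_, (hfactor Y hY).2⟩
    rw [hcoord η g hg, embed]
    rcases le_total 0 m with hm | hm
    · obtain ⟨μ, hμ⟩ : ∃ μ : ℕ, m = 0 + μ := ⟨m.toNat, by omega⟩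
      rw [S.negPow_eq_of_eq_add hμ]
      have hR : S.sqrtRoot ^ d * Y * S.sqrtRoot ^ d = S.root ^ μ * (Q * S.root ^ j) := by
        conv_lhs => enter [1, 1]; rw [show d = μ + μ + k by omega, pow_add, pow_add,
          S.sqrtRoot_pow_mul_pow]
        rw [← hPYD]
        simp only [mul_assoc]
      rw [hR]
      rfl
    -- for `m < 0` the element `R η` of `H` is compared with the resolvent in `H_m`
    · obtain ⟨i, hi⟩ : ∃ i : ℕ, 0 = m + i := ⟨(-m).toNat, by omega⟩
      rw [S.negPow_eq_of_eq_add hi]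
      have hR : S.root ^ i * (S.sqrtRoot ^ d * Y * S.sqrtRoot ^ d) = Q * S.root ^ j := by
        rw [← hPYD, show k = i + i + d by omega, pow_add, pow_add, S.sqrtRoot_pow_mul_pow]
        simp only [mul_assoc]
      rw [← mul_apply_eq_comp, ← mul_apply_eq_comp, hR]

/-- Two spaces of the scale which coincide as sets are isomorphic. -/
noncomputable def scaleEquiv {a b : ℤ} (hab : S.scale a ≤ S.scale b) (hba : S.scale b ≤ S.scale a) :
    S.scale a ≃L[ℂ] S.scale b :=
  ContinuousLinearEquiv.equivOfInverse (S.inclusion hab) (S.inclusion hba)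
    (fun _ => Subtype.ext rfl) fun _ => Subtype.ext rfl

/-- The conclusion of `exists_resolvent_of_le` without restriction on the indices: if they are in
the wrong order, the scale collapses and `(0, 0)` can be substituted for `(m, n)`. -/
theorem exists_resolvent {A : S.Total →ₗ.[ℂ] S.Total} (hA : S.IsAdjointOperator A A)
    {m n : ℤ} (hmn : S.scale m ≤ S.scale n) (hn : S.scale 0 ≤ S.scale n) {r : ℝ}
    {T : S.scale m →L[ℂ] S.scale n} (hT : S.IsRepresentative A T) (e : S.scale m ≃L[ℂ] S.scale n)
    (he : (e : S.scale m →L[ℂ] S.scale n) = T - (r : ℂ) • S.inclusion hmn) :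
    ∃ R : H →L[ℂ] H, IsSelfAdjoint R ∧
      (∀ (η : H) (g : S.scale n), (g : S.Total) = S.embed η →
        (e.symm g : S.Total) = S.embed (R η)) ∧
      (IsCompactOperator (S.inclusion hmn) → IsCompactOperator R) := by
  by_cases h : n ≤ m ∧ n ≤ 0
  · exact exists_resolvent_of_le hA h.1 h.2 hmn hT e he
  · have hall : ∀ c d : ℤ, S.scale c ≤ S.scale d := by
      rw [not_and_or, not_le, not_le] at h
      rcases h with h | h
      · exact S.scale_le_scale_of_lt_of_le h hmn
      · exact S.scale_le_scale_of_lt_of_le h hn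
    let T₀ : S.scale 0 →L[ℂ] S.scale 0 := S.inclusion (hall n 0) ∘L T ∘L S.inclusion (hall 0 m)
    have hT₀ : S.IsRepresentative A T₀ := fun f => hT (S.inclusion (hall 0 m) f)
    let e₀ : S.scale 0 ≃L[ℂ] S.scale 0 := (scaleEquiv (hall 0 m) (hall m 0)).trans
      (e.trans (scaleEquiv (hall n 0) (hall 0 n)))
    have he₀ : (e₀ : S.scale 0 →L[ℂ] S.scale 0) = T₀ - (r : ℂ) • S.inclusion le_rfl := by
      ext f
      have := congrArg (fun F : S.scale m →L[ℂ] S.scale n =>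
        (F (S.inclusion (hall 0 m) f) : S.Total)) he
      exact this
    obtain ⟨R, hR, hRe, hRc⟩ := exists_resolvent_of_le hA le_rfl le_rfl le_rfl hT₀ e₀ he₀
    refine ⟨R, hR, fun η g hg => hRe η (S.inclusion (hall n 0) g) hg, fun hc => hRc ?_⟩
    exact (hc.comp_clm (S.inclusion (hall 0 m))).clm_comp (S.inclusion (hall n 0))

end BoundedMetric

/-! ### The self-adjoint restriction and its spectrum -/

theorem mainTheorem8 {H : Type*} [NormedAddCommGroup H] [InnerProductSpace ℂ H] [CompleteSpace H]
    (G : H →ₗ.[ℂ] H) (hG : IsMetricOperator G)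
    (S : BoundedMetric H) (hS : IsScaleBase G S)
    (A : S.Total →ₗ.[ℂ] S.Total) (hA : S.IsSymmetricOperator A)
    (m n : ℤ) (hmn : S.scale m ≤ S.scale n) (hn : S.scale 0 ≤ S.scale n)
    (lam : ℝ)
    (T : S.scale m →L[ℂ] S.scale n) (hT : S.IsRepresentative A T)
    (hinv : ∃ e : S.scale m ≃L[ℂ] S.scale n,
      (e : S.scale m →L[ℂ] S.scale n) = T - (lam : ℂ) • S.inclusion hmn) :
    ∃ A₀ : H →ₗ.[ℂ] H,
      (IsSelfAdjoint A₀ ∧ S.IsRestriction T A₀ ∧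
        (∀ A₁ : H →ₗ.[ℂ] H, IsSelfAdjoint A₁ → S.IsRestriction T A₁ → A₁ = A₀) ∧
        Dense (A₀.domain : Set H) ∧
        (∀ ξ : H, ξ ∈ A₀.domain ↔
          ∃ f : S.scale m, (f : S.Total) = S.embed ξ ∧ ∃ η : H, (T f : S.Total) = S.embed η) ∧
        (lam : ℂ) ∈ opResolventSet A₀) ∧
      (IsCompactOperator (S.inclusion hmn) →
        opSpectrum A₀ = opPointSpectrum A₀ ∧
        (∀ z ∈ opPointSpectrum A₀, FiniteDimensional ℂ (opEigenspace A₀ z)) ∧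
        opContinuousSpectrum A₀ = ∅ ∧
        (⨆ z : ℂ, opEigenspace A₀ z).topologicalClosure = ⊤) := by
  obtain ⟨e, he⟩ := hinv
  obtain ⟨R, hsa, hRe, hRc⟩ := BoundedMetric.exists_resolvent hA.2 hmn hn hT e he
  have hembed : Function.Injective S.embed := S.negPow_injective 0
  have heT : ∀ f : S.scale m, (e f : S.Total) = (T f : S.Total) - (lam : ℂ) • (f : S.Total) :=
    fun f => congrArg (fun F : S.scale m →L[ℂ] S.scale n => (F f : S.Total)) he
  have hlift : ∀ η : H, ∃ g : S.scale n, (g : S.Total) = S.embed η := fun η =>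
    ⟨⟨S.embed η, hn ⟨η, rfl⟩⟩, rfl⟩
  have hinj : Function.Injective R := by
    intro x y hxy
    obtain ⟨g, hg⟩ := hlift x
    obtain ⟨g', hg'⟩ := hlift y
    have h : (e.symm g : S.Total) = e.symm g' := by rw [hRe x g hg, hRe y g' hg', hxy]
    apply hembed
    rw [← hg, ← hg', e.symm.injective (Subtype.ext h)]
  -- `f ∈ H ∩ H_m` with `T f = η ∈ H` is the value of the resolvent at `η - λ f`
  have hres : ∀ (ξ η : H) (f : S.scale m), (f : S.Total) = S.embed ξ →
      (T f : S.Total) = S.embed η → R (η - (lam : ℂ) • ξ) = ξ := by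
    intro ξ η f hf hη
    have h := hRe (η - (lam : ℂ) • ξ) (e f) (by rw [heT, hf, hη, map_sub, map_smul])
    rw [e.symm_apply_apply, hf] at h
    exact (hembed h).symm
  have hrestr : S.IsRestriction T (LinearPMap.ofResolvent R hinj lam) := by
    rintro ⟨_, η, rfl⟩
    obtain ⟨g, hg⟩ := hlift η
    refine ⟨e.symm g, hRe η g hg, ?_⟩
    change (T (e.symm g) : S.Total) = S.embed
      (LinearPMap.ofResolvent R hinj lam ⟨R η, LinearPMap.mem_ofResolvent_domain η⟩)
    have h := heT (e.symm g)
    rw [e.apply_symm_apply, hg, hRe η g hg] at h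
    rw [LinearPMap.ofResolvent_apply, map_add, map_smul, h, sub_add_cancel]
  have hA₀ := LinearPMap.isSelfAdjoint_ofResolvent (hR := hinj) hsa lam
  refine ⟨LinearPMap.ofResolvent R hinj lam, ⟨hA₀, hrestr, fun A₁ hA₁ hr => ?_, hA₀.dense_domain,
    fun ξ => ⟨fun hξ => ?_, ?_⟩, LinearPMap.mem_opResolventSet_ofResolvent⟩, fun hc => ?_⟩
  · refine LinearPMap.eq_of_isSelfAdjoint_of_le hA₁ hA₀ (LinearPMap.le_of_le_graph ?_)
    rintro ⟨ξ, η⟩ h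
    rw [LinearPMap.mem_graph_iff] at h ⊢
    obtain ⟨x, rfl, rfl⟩ := h
    obtain ⟨f, hf, hTf⟩ := hr x
    have h := hres x (A₁ x) f hf hTf
    refine ⟨⟨x, _, h⟩, rfl, ?_⟩
    have h' := LinearPMap.ofResolvent_apply (hR := hinj) (z := lam) (A₁ x - (lam : ℂ) • (x : H))
    simp only [h, sub_add_cancel] at h'
    exact h'
  · obtain ⟨f, hf, hTf⟩ := hrestr ⟨ξ, hξ⟩
    exact ⟨f, hf, _, hTf⟩
  · rintro ⟨f, hf, η, hη⟩
    exact ⟨_, hres ξ η f hf hη⟩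
  · have hspec := LinearPMap.opSpectrum_ofResolvent_eq_opPointSpectrum (hR := hinj) (z := lam)
      (hRc hc)
    exact ⟨hspec, fun z hz => LinearPMap.finiteDimensional_opEigenspace_ofResolvent (hRc hc) hz,
      opContinuousSpectrum_eq_empty hspec,
      LinearPMap.topologicalClosure_iSup_opEigenspace_ofResolvent hsa (hRc hc)⟩
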